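/- Let $n\ge 1$ and $m\ge 0$ be integers. Write points of $\mathbb R^n=\mathbb R^{n-1}\times\mathbb R$ as $x=(x',x_n)$, and let $\mathtt x'=(\mathtt x_1,\dots,\mathtt x_{n-1})$, $\mathtt x=(\mathtt x',\mathtt x_n)$, $e_n=(0,\dots,0,1)$ and $\pi_n(x',x_n)=(x',0)$. Let $g_1,\dots,g_m,g_{m+1}\in\mathbb R[\mathtt x']$ be polynomials such that $g_{m+1}(x')>1$ for every $x'\in\mathbb R^{n-1}$, and set $$A=\{x\in\mathbb R^n:\ g_1(x')>0,\dots,g_m(x')>0,\ x_n=0\}.$$ Then there exists a polynomial $Q\in\mathbb R[\mathtt x]$ such that: (i) $\displaystyle\{x\in\mathbb R^n: Q(x)\le 0\}\subset\{a+\lambda e_n:\ a\in A,\ \lambda\in\mathbb R\}\cap\Big\{x\in\mathbb R^n:\ |x_n|>\max\Big\{g_{m+1}(x'),\ \frac{g_{m+1}(x')}{\sqrt{g_1(x')\cdots g_m(x')}}\Big\}\Big\}$ (an empty product is $1$; on the first set on the right all $g_i(x')$ with $i\le m$ are positive). (ii) For each $(x',0)\in A$ there exist a positive root $r\ge g_{m+1}(x')$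 of the univariate polynomial $Q(x',\mathtt t)$ and a real number $t\ge r$ such that $Q(x',t)=-1$. (iii) The set $S=\{y+\lambda e_n:\ y\in\mathbb R^n,\ Q(y)\le 0,\ y_n>0,\ \lambda\ge 0\}$ satisfies $\pi_n(S)=A$. In addition, for each $(x',x_n)\in S$ there exist $r_n>0$ and $t_n\ge 0$ such that $x_n=r_n+t_n$ and $Q(x',r_n)=0$. -/

import Mathlib

open MvPolynomial

/-! Points of `ℝⁿ`, `n = d + 1`, are functions `x : Fin (d + 1) → ℝ`. In `x = (x', x_n)` the point
`x' ∈ ℝⁿ⁻¹` is `Fin.init x` and `x_n` is `x (Fin.last d)`; conversely `(x', t)` is `Fin.snoc x' t`. -/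

namespace Pecker

/-- The point `(x', t)` of `ℝⁿ = ℝⁿ⁻¹ × ℝ`. -/
def pt {d : ℕ} (x' : Fin d → ℝ) (t : ℝ) : Fin (d + 1) → ℝ :=
  Fin.snoc (α := fun _ => ℝ) x' t

/-- The last vector `eₙ = (0, …, 0, 1)` of the standard basis of `ℝⁿ`. -/
def en (d : ℕ) : Fin (d + 1) → ℝ := Pi.single (Fin.last d) 1

/-- The vertical projection `πₙ : ℝⁿ → ℝⁿ`, `(x', x_n) ↦ (x', 0)`. -/
def piN {d : ℕ} (x : Fin (d + 1) → ℝ) : Fin (d + 1) → ℝ := pt (Fin.init x) 0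

/-- The cylinder `{x + λ v : x ∈ X, λ ∈ ℝ}` of base `X` in the direction `v`. -/
def cyl {d : ℕ} (X : Set (Fin d → ℝ)) (v : Fin d → ℝ) : Set (Fin d → ℝ) :=
  {y | ∃ x ∈ X, ∃ c : ℝ, y = x + c • v}

/-- The positive cylinder `{x + λ v : x ∈ X, λ ≥ 0}` of base `X` in the direction `v`. -/
def posCyl {d : ℕ} (X : Set (Fin d → ℝ)) (v : Fin d → ℝ) : Set (Fin d → ℝ) :=
  {y | ∃ x ∈ X, ∃ c : ℝ, 0 ≤ c ∧ y = x + c • v}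

/-- A tuple `(g₁, …, g_m, g_{m+1})` of polynomials in `ℝ[x']` is admissible if `g_{m+1} > 1` on
`ℝⁿ⁻¹`. -/
def IsAdmissible {d m : ℕ} (g : Fin (m + 1) → MvPolynomial (Fin d) ℝ) : Prop :=
  ∀ x' : Fin d → ℝ, 1 < eval x' (g (Fin.last m))

/-- The set `{g₁ > 0, …, g_m > 0, x_n = 0} ⊆ ℝⁿ`. -/
def setA {d m : ℕ} (g : Fin (m + 1) → MvPolynomial (Fin d) ℝ) : Set (Fin (d + 1) → ℝ) :=
  {x | (∀ i : Fin m, 0 < eval (Fin.init x) (g i.castSucc)) ∧ x (Fin.last d) = 0}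

/-- The positive vertical cylinder over `{Q ≤ 0, x_n > 0}`. -/
def setS {d : ℕ} (Q : MvPolynomial (Fin (d + 1)) ℝ) : Set (Fin (d + 1) → ℝ) :=
  posCyl {x | eval x Q ≤ 0 ∧ 0 < x (Fin.last d)} (en d)

end Pecker

namespace Pecker

/-! Put `p = g₁⋯g_m` and `G = g_{m+1}`. `exists_separating_polynomial` adds the conditions `f > 0`
one at a time, replacing `P` by `N(1+f²)P² + 1 - fN` with `N ≥ 0`. This is below `1` only if `N > 0`
and `(1+f²)P² < f`, which forces `f > 0` and `P² < 1`; at a root of `P` it equals `1 - fN`, which is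
at most `-1` for large `N`. Taking `h = p` and `L = G²(1+p²)` also pushes `{Q ≤ 0}` away from `x_n =
0`. Over `A`, `Q` is then positive at height `0` and later reaches `-1`, so intermediate values give
the roots. -/

@[simp] lemma pt_last {d : ℕ} (x : Fin d → ℝ) (t : ℝ) : pt x t (Fin.last d) = t := by
  simp [pt]

@[simp] lemma init_pt {d : ℕ} (x : Fin d → ℝ) (t : ℝ) :
    (Fin.init (pt x t) : Fin d → ℝ) = x := by
  simp [pt]

lemma pt_init_last {d : ℕ} (y : Fin (d + 1) → ℝ) :
    pt (Fin.init y) (y (Fin.last d)) = y := by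
  simp [pt]

lemma pt_add_smul_en {d : ℕ} (x : Fin d → ℝ) (t c : ℝ) :
    pt x t + c • en d = pt x (t + c) := by
  ext i
  refine Fin.lastCases ?_ (fun j => ?_) i
  · simp [en]
  · simp [en, pt, (Fin.castSucc_lt_last j).ne]

@[simp] lemma eval_pt_rename {d : ℕ} (x : Fin d → ℝ) (t : ℝ) (f : MvPolynomial (Fin d) ℝ) :
    eval (pt x t) (rename Fin.castSucc f) = eval x f := by
  rw [eval_rename]
  congr 2
  ext j
  simp [pt]

lemma pt_mem_setA {d m : ℕ} {g : Fin (m + 1) → MvPolynomial (Fin d) ℝ} {x : Fin d → ℝ} :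
    pt x 0 ∈ setA g ↔ ∀ i : Fin m, 0 < eval x (g i.castSucc) := by
  simp [setA]

lemma continuous_eval_pt {d : ℕ} (P : MvPolynomial (Fin (d + 1)) ℝ) (x : Fin d → ℝ) :
    Continuous fun t : ℝ => eval (pt x t) P := by
  refine P.continuous_eval.comp (continuous_pi fun i => ?_)
  refine Fin.lastCases ?_ (fun j => ?_) i
  · simpa using continuous_id'
  · simpa [pt] using continuous_const

/-- Intermediate value theorem along a vertical line, for decreasing values. -/
lemma exists_eval_pt_eq {d : ℕ} (P : MvPolynomial (Fin (d + 1)) ℝ) (x : Fin d → ℝ) {a b c : ℝ}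
    (hab : a ≤ b) (ha : c ≤ eval (pt x a) P) (hb : eval (pt x b) P ≤ c) :
    ∃ t, a ≤ t ∧ t ≤ b ∧ eval (pt x t) P = c := by
  obtain ⟨t, ht, h⟩ :=
    intermediate_value_Icc' hab (continuous_eval_pt P x).continuousOn ⟨hb, ha⟩
  exact ⟨t, ht.1, ht.2, h⟩

/-- A single polynomial inequality `P(x, t) < 1` forces finitely many strict inequalities in `x`
together with a lower bound on `t ^ 2`, while `P(x, ·)` still reaches `-1` whenever the
inequalities hold. -/
lemma exists_separating_polynomial {d : ℕ} (l : List (MvPolynomial (Fin d) ℝ)) :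
    ∀ h L : MvPolynomial (Fin d) ℝ, (∀ x, 0 ≤ eval x L) →
      ∃ P : MvPolynomial (Fin (d + 1)) ℝ,
        (∀ x t, eval (pt x t) P < 1 →
          (∀ f ∈ l, 0 < eval x f) ∧ eval x L < t ^ 2 * eval x h) ∧
        ∀ x, 0 < eval x h → (∀ f ∈ l, 0 < eval x f) → ∃ t, 0 ≤ t ∧ eval (pt x t) P ≤ -1 := by
  induction l with
  | nil =>
    intro h L hL
    refine ⟨rename Fin.castSucc L + 1 - X (Fin.last d) ^ 2 * rename Fin.castSucc h, ?_, ?_⟩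
    · intro x t ht
      simp only [map_add, map_sub, map_mul, map_pow, map_one, eval_X, eval_pt_rename,
        pt_last] at ht
      exact ⟨by simp, by linarith⟩
    · intro x hx _
      refine ⟨√((eval x L + 2) / eval x h), Real.sqrt_nonneg _, ?_⟩
      have := hL x
      simp only [map_add, map_sub, map_mul, map_pow, map_one, eval_X, eval_pt_rename, pt_last]
      rw [Real.sq_sqrt (by positivity), div_mul_cancel₀ _ hx.ne']
      linarith
  | cons f l ih =>
    intro h L hL
    -- The factor `f²` cancels once `f > 0` is known; the summand `2` makes `fN ≥ 2` at a root of
    -- `P`.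
    obtain ⟨P, hP, hP'⟩ := ih (h * f ^ 2) (L * f ^ 2 + 2) (fun x => by
      have := hL x
      simp only [map_add, map_mul, map_pow, map_ofNat]
      positivity)
    -- The factors `1 + h²` and `1 + f²` dominate `h` and `f` but stay positive for every sign.
    let N : MvPolynomial (Fin (d + 1)) ℝ :=
      X (Fin.last d) ^ 2 * rename Fin.castSucc ((1 + h ^ 2) * (1 + f ^ 2))
    have hN : ∀ x t, eval (pt x t) N = t ^ 2 * ((1 + eval x h ^ 2) * (1 + eval x f ^ 2)) := by
      intro x t
      simp only [N, map_mul, map_pow, eval_X, pt_last, eval_pt_rename, map_add, map_one]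
    have hN0 : ∀ x t, 0 ≤ eval (pt x t) N := by
      intro x t
      rw [hN]
      positivity
    let Q : MvPolynomial (Fin (d + 1)) ℝ :=
      N * rename Fin.castSucc (1 + f ^ 2) * P ^ 2 + 1 - rename Fin.castSucc f * N
    have hQ : ∀ x t, eval (pt x t) Q = eval (pt x t) N * (1 + eval x f ^ 2) * eval (pt x t) P ^ 2
        + 1 - eval x f * eval (pt x t) N := by
      intro x t
      simp only [Q, map_mul, map_pow, eval_pt_rename, map_add, map_sub, map_one]
    refine ⟨Q, ?_, ?_⟩
    · intro x t ht
      rw [hQ] at ht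
      have hpos : 0 < eval (pt x t) N := by
        refine (hN0 x t).lt_of_ne' fun h0 => ?_
        simp [h0] at ht
      have hlt : (1 + eval x f ^ 2) * eval (pt x t) P ^ 2 < eval x f := by
        refine lt_of_mul_lt_mul_left ?_ hpos.le
        linarith
      have hf : 0 < eval x f := lt_of_le_of_lt (by positivity) hlt
      have hP1 : eval (pt x t) P < 1 := by
        by_contra! hge
        -- `P ≥ 1` would give `1 + f² < f`.
        nlinarith [one_le_pow₀ hge (n := 2), sq_nonneg (eval x f - 1), sq_nonneg (eval x f)]
      obtain ⟨hl, hL'⟩ := hP x t hP1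
      refine ⟨by simpa using ⟨hf, hl⟩, ?_⟩
      simp only [map_add, map_mul, map_pow, map_ofNat] at hL'
      refine lt_of_mul_lt_mul_right ?_ (sq_nonneg (eval x f))
      linarith
    · intro x hx hl
      have hf : 0 < eval x f := hl f (by simp)
      obtain ⟨T, hT, hPT⟩ := hP' x (by simp only [map_mul, map_pow]; positivity)
        fun q hq => hl q (by simp [hq])
      have hstart : 0 ≤ eval (pt x 0) P := by
        by_contra! hneg
        have hlt := (hP x 0 (by linarith)).2
        simp only [map_add, map_mul, map_pow, map_ofNat] at hlt
        linarith [mul_nonneg (hL x) (sq_nonneg (eval x f))]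
      obtain ⟨t, ht, -, hroot⟩ := exists_eval_pt_eq P x hT hstart (by linarith)
      refine ⟨t, ht, ?_⟩
      have hbound := (hP x t (by linarith)).2
      simp only [map_add, map_mul, map_pow, map_ofNat] at hbound
      have hL' : 2 ≤ t ^ 2 * (eval x h * eval x f ^ 2) := by
        linarith [mul_nonneg (hL x) (sq_nonneg (eval x f))]
      have hle : t ^ 2 * (eval x h * eval x f ^ 2) ≤ eval x f * eval (pt x t) N := by
        have h1 : eval x h ≤ 1 + eval x h ^ 2 := by nlinarith [sq_nonneg (eval x h - 1)]
        have h2 : eval x f ≤ 1 + eval x f ^ 2 := by nlinarith [sq_nonneg (eval x f - 1)]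
        calc t ^ 2 * (eval x h * eval x f ^ 2)
            = eval x f * (t ^ 2 * (eval x h * eval x f)) := by ring
          _ ≤ _ := by rw [hN]; gcongr
      rw [hQ, hroot]
      linarith

/-- Dividing by `p` gives `t² > G²(p + 1/p)`, which exceeds both `G²` and `G²/p`. -/
lemma max_lt_abs_of_mul_lt {G p t : ℝ} (hG : 0 < G) (hp : 0 < p)
    (h : G ^ 2 * (1 + p ^ 2) < t ^ 2 * p) : max G (G / √p) < |t| := by
  refine max_lt (abs_lt_of_sq_lt_sq' ?_ (abs_nonneg t)).2
    (abs_lt_of_sq_lt_sq' ?_ (abs_nonneg t)).2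
  · rw [sq_abs]
    refine lt_of_mul_lt_mul_right ?_ hp.le
    nlinarith [mul_pos hG hG, mul_nonneg (sq_nonneg G) (sq_nonneg (p - 1)),
      mul_pos (mul_pos hG hG) hp]
  · rw [sq_abs, div_pow, Real.sq_sqrt hp.le, div_lt_iff₀ hp]
    nlinarith [mul_nonneg (sq_nonneg G) (sq_nonneg p)]

end Pecker

theorem lemma3p2 {d m : ℕ} (g : Fin (m + 1) → MvPolynomial (Fin d) ℝ)
    (hg : Pecker.IsAdmissible g) :
    ∃ Q : MvPolynomial (Fin (d + 1)) ℝ,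
      ({x : Fin (d + 1) → ℝ | MvPolynomial.eval x Q ≤ 0} ⊆
        Pecker.cyl (Pecker.setA g) (Pecker.en d) ∩
          {x : Fin (d + 1) → ℝ |
            max (MvPolynomial.eval (Fin.init x) (g (Fin.last m)))
              (MvPolynomial.eval (Fin.init x) (g (Fin.last m)) /
                Real.sqrt (∏ i : Fin m, MvPolynomial.eval (Fin.init x) (g i.castSucc)))
              < |x (Fin.last d)|}) ∧
      (∀ x' : Fin d → ℝ, Pecker.pt x' 0 ∈ Pecker.setA g →
        ∃ r : ℝ, 0 < r ∧ MvPolynomial.eval x' (g (Fin.last m)) ≤ r ∧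
          MvPolynomial.eval (Pecker.pt x' r) Q = 0 ∧
          ∃ t : ℝ, r ≤ t ∧ MvPolynomial.eval (Pecker.pt x' t) Q = -1) ∧
      Pecker.piN '' Pecker.setS Q = Pecker.setA g ∧
      (∀ (x' : Fin d → ℝ) (xn : ℝ), Pecker.pt x' xn ∈ Pecker.setS Q →
        ∃ rn tn : ℝ, 0 < rn ∧ 0 ≤ tn ∧ xn = rn + tn ∧
          MvPolynomial.eval (Pecker.pt x' rn) Q = 0) := by
  obtain ⟨Q, hQ, hQ'⟩ := Pecker.exists_separating_polynomial
    (List.ofFn fun i : Fin m => g i.castSucc) (∏ i : Fin m, g i.castSucc)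
    (g (Fin.last m) ^ 2 * (1 + (∏ i : Fin m, g i.castSucc) ^ 2)) (fun x => by
      simp only [map_add, map_mul, map_pow, map_one]
      positivity)
  simp only [List.forall_mem_ofFn_iff, map_add, map_mul, map_pow, map_one, map_prod] at hQ hQ'
  have hneg : ∀ x t, eval (Pecker.pt x t) Q ≤ 0 →
      (∀ i : Fin m, 0 < eval x (g i.castSucc)) ∧
      max (eval x (g (Fin.last m)))
        (eval x (g (Fin.last m)) / √(∏ i : Fin m, eval x (g i.castSucc))) < |t| := by
    intro x t h
    obtain ⟨hpos, hlt⟩ := hQ x t (by linarith)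
    exact ⟨hpos, Pecker.max_lt_abs_of_mul_lt (zero_lt_one.trans (hg x))
      (Finset.prod_pos fun i _ => hpos i) hlt⟩
  -- Otherwise `hneg` would give `g_{m+1}(x) < |0|`, against `g_{m+1} > 1`.
  have hzero : ∀ x, 0 < eval (Pecker.pt x 0) Q := by
    intro x
    by_contra! h
    have := (le_max_left _ _).trans_lt (hneg x 0 h).2
    rw [abs_zero] at this
    linarith [hg x]
  have hroot : ∀ x' : Fin d → ℝ, Pecker.pt x' 0 ∈ Pecker.setA g →
      ∃ r : ℝ, 0 < r ∧ eval x' (g (Fin.last m)) ≤ r ∧ eval (Pecker.pt x' r) Q = 0 ∧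
        ∃ t : ℝ, r ≤ t ∧ eval (Pecker.pt x' t) Q = -1 := by
    intro x hx
    rw [Pecker.pt_mem_setA] at hx
    obtain ⟨T, hT, hQT⟩ := hQ' x (Finset.prod_pos fun i _ => hx i) hx
    obtain ⟨r, hr, hrT, hr0⟩ :=
      Pecker.exists_eval_pt_eq Q x hT (hzero x).le (by linarith)
    obtain ⟨t, hrt, -, ht⟩ :=
      Pecker.exists_eval_pt_eq Q x (c := -1) hrT (by linarith) hQT
    have hGr := (le_max_left _ _).trans_lt (hneg x r hr0.le).2
    rw [abs_of_nonneg hr] at hGr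
    exact ⟨r, by linarith [hg x], hGr.le, hr0, t, hrt, ht⟩
  refine ⟨Q, ?_, hroot, ?_, ?_⟩
  · intro y hy
    rw [← Pecker.pt_init_last y] at hy ⊢
    obtain ⟨hpos, hlt⟩ := hneg _ _ hy
    refine ⟨⟨Pecker.pt (Fin.init y) 0, Pecker.pt_mem_setA.2 hpos, y (Fin.last d), ?_⟩, ?_⟩
    · rw [Pecker.pt_add_smul_en, zero_add]
    · simpa using hlt
  · ext a
    constructor
    · rintro ⟨_, ⟨y, ⟨hy, -⟩, c, -, rfl⟩, rfl⟩
      rw [← Pecker.pt_init_last y] at hy ⊢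
      rw [Pecker.pt_add_smul_en, Pecker.piN, Pecker.init_pt, Pecker.pt_mem_setA]
      exact (hneg _ _ hy).1
    · intro ha
      have hpt : Pecker.pt (Fin.init a) 0 = a := by
        rw [← ha.2, Pecker.pt_init_last]
      obtain ⟨r, hr, -, hr0, -⟩ := hroot (Fin.init a) (by rwa [hpt])
      refine ⟨Pecker.pt (Fin.init a) r, ⟨_, ⟨hr0.le, by simpa using hr⟩, 0, le_rfl, by simp⟩, ?_⟩
      rw [Pecker.piN, Pecker.init_pt, hpt]
  · rintro x xn ⟨y, ⟨hy, hpos⟩, c, hc, hxy⟩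
    rw [← Pecker.pt_init_last y] at hy hxy
    rw [Pecker.pt_add_smul_en] at hxy
    have hx := congrArg (Fin.init (α := fun _ => ℝ)) hxy
    have hxn := congrFun hxy (Fin.last d)
    simp only [Pecker.init_pt, Pecker.pt_last] at hx hxn
    rw [← hx] at hy
    obtain ⟨r, hr, hry, hr0⟩ := Pecker.exists_eval_pt_eq Q x hpos.le (hzero x).le hy
    have hrne : r ≠ 0 := by
      rintro rfl
      exact (hzero x).ne' hr0
    exact ⟨r, xn - r, hr.lt_of_ne' hrne, by linarith, by ring, hr0⟩
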